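/- A (left-invariant) circular order on a group $G$ is a map $\varphi : G^3 \to \{-1,0,1\}$ such that (i) $\varphi(x,y,z)=0$ if and only if two of $x,y,z$ are equal; (ii) $\varphi(g_1,g_2,g_3)-\varphi(g_0,g_2,g_3)+\varphi(g_0,g_1,g_3)-\varphi(g_0,g_1,g_2)=0$ for all $g_0,g_1,g_2,g_3\in G$; (iii) $\varphi(gx,gy,gz)=\varphi(x,y,z)$ for all $g,x,y,z\in G$. Let $\mathrm{CO}(G)\subseteq\{-1,0,1\}^{G^3}$ be the space of all circular orders on $G$, with the subspace topology of the product topology, $\{-1,0,1\}$ being discrete. A dynamical realization of $c\in\mathrm{CO}(G)$ is a homomorphism $r:G\to\mathrm{Homeo}_+(S^1)$, $S^1=\mathbb{R}/\mathbb{Z}$, together with a marked point $p\in S^1$ with trivial stabilizer, such that for all $x,y,z\in G$ the value $c(x,y,z)$ is $+1$, $-1$ or $0$ according as the triple $(r(x)p,r(y)p,r(z)p)$ is positively oriented, negatively oriented or has a repeated entry, and such that every connected component of the complement of the closure of the orbit $r(G)p$ has its endpoints in $r(G)p$. Let $\mathrm{CO}_{\mathrm{rot}}(G)$ be the set of those $c\in\mathrm{CO}(G)$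 that have a dynamical realization $(r,p)$ in which every $r(g)$ is a rotation $x\mapsto x+t$ of $S^1$. **Theorem.** For every finitely generated abelian group $A$, the set $\mathrm{CO}_{\mathrm{rot}}(A)$ of rotation orders is dense in the space $\mathrm{CO}(A)$ of all circular orders on $A$. -/

import Mathlib

/-- A left-invariant circular order on a group `G`: a function `φ : G³ → {-1, 0, 1}` which vanishes
precisely on the triples with a repeated entry, is a 2-cocycle, and is invariant under left
multiplication. -/
structure IsCircularOrder {G : Type*} [Group G] (φ : G × G × G → SignType) : Prop where
  eq_zero_iff : ∀ x y z : G, φ (x, y, z) = 0 ↔ x = y ∨ y = z ∨ x = z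
  cocycle : ∀ g₀ g₁ g₂ g₃ : G,
    (φ (g₁, g₂, g₃) : ℤ) - (φ (g₀, g₂, g₃) : ℤ) + (φ (g₀, g₁, g₃) : ℤ) - (φ (g₀, g₁, g₂) : ℤ) = 0
  homogeneous : ∀ g x y z : G, φ (g * x, g * y, g * z) = φ (x, y, z)

/-- The space `CO(G)` of left-invariant circular orders on `G`, with the subspace topology from
the product topology on `{-1, 0, 1}^(G³)`, where `SignType = {-1, 0, 1}` is discrete. -/
abbrev CO (G : Type*) [Group G] : Type _ := {φ : G × G × G → SignType // IsCircularOrder φ}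

open Classical in
/-- The standard circular order of the circle `ℝ / ℤ`: `+1` on positively oriented triples,
`-1` on negatively oriented triples, `0` on triples with a repeated entry. -/
noncomputable def circleOrientation (x y z : UnitAddCircle) : SignType :=
  if sbtw x y z then 1 else if sbtw z y x then -1 else 0

/-- The group `Homeo₊(S¹)` of orientation-preserving homeomorphisms of the circle. -/
def HomeoPlus : Subgroup (UnitAddCircle ≃ₜ UnitAddCircle) where
  carrier := {f | ∀ x y z, circleOrientation (f x) (f y) (f z) = circleOrientation x y z}
  one_mem' := fun _ _ _ => rfl
  mul_mem' := fun {f g} hf hg x y z => (hf (g x) (g y) (g z)).trans (hg x y z)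
  inv_mem' := fun {f} hf x y z => by
    have h := hf (f.symm x) (f.symm y) (f.symm z)
    simp only [Homeomorph.apply_symm_apply] at h
    exact h.symm

/-- `(r, p)` is a dynamical realization of the circular order `c`, i.e. an action `r` of `G` on
the circle by orientation-preserving homeomorphisms, with a marked point `p`, such that
`g ↦ r g p` is an injective map taking `c` to the standard circular order of the circle, and such
that the gaps of the orbit of `p` (the connected components of the complement of its closure) are
intervals between adjacent points of the orbit, i.e. their endpoints are in the orbit.  On the gaps
the action is only required to be by homeomorphisms. -/
structure IsDynamicalRealization {G : Type*} [Group G] (c : CO G) (r : G →* HomeoPlus)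
    (p : UnitAddCircle) : Prop where
  trivial_stabilizer : ∀ g : G, (r g).1 p = p → g = 1
  order_eq : ∀ x y z : G, c.1 (x, y, z) = circleOrientation ((r x).1 p) ((r y).1 p) ((r z).1 p)
  gap : ∀ x ∉ closure (Set.range fun g : G => (r g).1 p),
    frontier (connectedComponentIn (closure (Set.range fun g : G => (r g).1 p))ᶜ x) ⊆
      Set.range fun g : G => (r g).1 p

/-- The action `r` is a rotation action: every group element acts as a rotation `x ↦ x + t`. -/
def IsRotationAction {G : Type*} [Group G] (r : G →* HomeoPlus) : Prop :=
  ∀ g : G, ∃ t : UnitAddCircle, ∀ x : UnitAddCircle, (r g).1 x = x + t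

/-- The set `CO_rot(G)` of rotation orders: the circular orders which have a dynamical realization
that is a rotation action. -/
def COrot (G : Type*) [Group G] : Set (CO G) :=
  {c | ∃ (r : G →* HomeoPlus) (p : UnitAddCircle),
    IsDynamicalRealization c r p ∧ IsRotationAction r}

/-! A circular order `c` on `A` unwraps to a linear order on a central extension of `A` by ℤ, as the
circle unwraps to the line. The extension cocycle `liftCocycle` is symmetric, so `CircularLift c` is
a linearly ordered abelian group; let z be the positive generator of ℤ. Each element of `A` has one
lift in [0, z), and `c` is read off from how these lifts compare (`apply_eq_cmpSign`).

Fix finitely many elements of `A`. The Hahn embedding, followed by a combination of coefficients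
with fast-shrinking weights, gives a homomorphism ψ to ℝ that respects the order of their lifts. A
small generic perturbation makes ψ injective; this uses countability of `A`. Scaled so that ψ(z) = 1
(`exists_addMonoidHom_real_strictMonoOn`), ψ descends to an injective character to ℝ/ℤ. The rotation
order it induces (`pullbackOrder_mem_COrot`) agrees with `c` on the chosen elements. -/

/-! ### Real homomorphisms of ordered abelian groups -/

open Topology Filter in
/-- Given a linearly ordered family of additive functionals, some combination of finitely many of
them is positive on every prescribed element whose first nonzero value is positive. -/
theorem exists_addMonoidHom_pos_of_leading_pos {Γ M : Type*} [LinearOrder Γ] [AddCommGroup M]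
    (coef : Γ → M →+ ℝ) (P : Finset M) (S : Finset Γ) :
    ∃ ψ : M →+ ℝ, ∀ p ∈ P, ∀ s ∈ S, (∀ j < s, coef j p = 0) → 0 < coef s p → 0 < ψ p := by
  induction S using Finset.induction_on_min with
  | empty => exact ⟨0, by simp⟩
  | insert a S ha ih =>
    obtain ⟨ψ, hψ⟩ := ih
    have key : ∀ p ∈ P, ∀ᶠ ε : ℝ in 𝓝[>] 0, 0 < coef a p → 0 < coef a p + ε * ψ p := by
      intro p _
      by_cases hp : 0 < coef a p
      · have hc : ContinuousAt (fun ε : ℝ => coef a p + ε * ψ p) 0 := by fun_prop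
        have : ∀ᶠ ε : ℝ in 𝓝 0, 0 < coef a p + ε * ψ p :=
          hc.eventually (lt_mem_nhds (by simpa using hp))
        exact (this.filter_mono nhdsWithin_le_nhds).mono fun _ h _ => h
      · exact Eventually.of_forall fun _ h => absurd h hp
    obtain ⟨ε, hε, hε0⟩ :=
      (((eventually_all_finset P).2 key).and self_mem_nhdsWithin).exists
    refine ⟨coef a + (AddMonoidHom.mulLeft ε).comp ψ, fun p hp s hs hz hpos => ?_⟩
    simp only [AddMonoidHom.add_apply, AddMonoidHom.comp_apply, AddMonoidHom.coe_mulLeft]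
    -- Leading index `a`: smallness of ε suffices. Later leading index: `coef a` vanishes, so any ε
    -- > 0 works.
    rcases Finset.mem_insert.1 hs with rfl | hs
    · exact hε p hp hpos
    · rw [hz a (ha s hs), zero_add]
      exact mul_pos hε0 (hψ p hp s hs hz hpos)

/-- Finitely many positive elements of a linearly ordered abelian group are positive under some
homomorphism to the reals. -/
theorem exists_addMonoidHom_real_pos {M : Type*} [AddCommGroup M] [LinearOrder M]
    [IsOrderedAddMonoid M] (P : Finset M) (hP : ∀ p ∈ P, 0 < p) :
    ∃ ψ : M →+ ℝ, ∀ p ∈ P, 0 < ψ p := by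
  classical
  obtain ⟨f, hf, -⟩ := hahnEmbedding_isOrderedAddMonoid M
  let coef (i : FiniteArchimedeanClass M) : M →+ ℝ :=
    { toFun := fun m => (ofLex (f m)).coeff i
      map_zero' := by simp
      map_add' := by simp }
  have hlead : ∀ p : P, ∃ i, (∀ j < i, coef j p = 0) ∧ 0 < coef i p := by
    rintro ⟨p, hp⟩
    have h : f 0 < f p := ((OrderHomClass.mono f).strictMono_of_injective hf) (hP p hp)
    rw [HahnSeries.lt_iff] at h
    obtain ⟨i, h1, h2⟩ := h
    exact ⟨i, fun j hj => by simpa [coef] using (h1 j hj).symm, by simpa [coef] using h2⟩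
  choose i hi using hlead
  obtain ⟨ψ, hψ⟩ := exists_addMonoidHom_pos_of_leading_pos coef P (Finset.univ.image i)
  exact ⟨ψ, fun p hp => hψ p hp (i ⟨p, hp⟩) (by simp) (hi ⟨p, hp⟩).1 (hi ⟨p, hp⟩).2⟩

/-- A countable torsion-free abelian group embeds into the additive group of the reals. -/
theorem exists_addMonoidHom_real_injective_of_countable (M : Type*) [AddCommGroup M]
    [IsAddTorsionFree M] [Countable M] : ∃ η : M →+ ℝ, Function.Injective η := by
  have : Countable (DivisibleHull M) := by
    have h : Function.Surjective fun x : M × ℕ+ => DivisibleHull.mk x.1 x.2 := fun x => by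
      induction x with
      | mk m s => exact ⟨(m, s), rfl⟩
    exact h.countable
  obtain ⟨g, hg⟩ := (lift_rank_le_iff_exists_linearMap (R := ℚ) (M := DivisibleHull M)
    (M' := ℝ)).1 (by
      rw [Real.rank_rat_real, Cardinal.lift_continuum]
      refine le_trans (Cardinal.lift_le.2 (rank_le_card ℚ (DivisibleHull M))) ?_
      refine le_trans ?_ Cardinal.aleph0_le_continuum
      rw [Cardinal.lift_le_aleph0]
      exact Cardinal.mk_le_aleph0)
  exact ⟨g.toAddMonoidHom.comp (DivisibleHull.coeAddMonoidHom M),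
    hg.comp DivisibleHull.coe_injective⟩

open Topology Filter in
/-- In a countable linearly ordered abelian group, finitely many positive elements are positive
under some embedding into the reals. -/
theorem exists_addMonoidHom_real_injective_pos {M : Type*} [AddCommGroup M] [LinearOrder M]
    [IsOrderedAddMonoid M] [Countable M] (P : Finset M) (hP : ∀ p ∈ P, 0 < p) :
    ∃ ψ : M →+ ℝ, Function.Injective ψ ∧ ∀ p ∈ P, 0 < ψ p := by
  obtain ⟨ψ, hψ⟩ := exists_addMonoidHom_real_pos P hP
  obtain ⟨η, hη⟩ := exists_addMonoidHom_real_injective_of_countable M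
  have hne : ∀ a : M, a ≠ 0 → η a ≠ 0 := fun a ha h => ha (hη (by simpa using h))
  have hpos : ∀ᶠ ε : ℝ in 𝓝 0, ∀ p ∈ P, 0 < ψ p + ε * η p := by
    refine (eventually_all_finset P).2 fun p hp => ?_
    have hc : ContinuousAt (fun ε : ℝ => ψ p + ε * η p) 0 := by fun_prop
    exact hc.eventually (lt_mem_nhds (by simpa using hψ p hp))
  -- `ψ + ε η` kills a nonzero `a` for exactly one ε, so only countably many ε are bad.
  have hcount : (Set.range fun a : M => -ψ a / η a).Countable := Set.countable_range _
  obtain ⟨ε, hε, hεP⟩ := (hcount.dense_compl ℝ).inter_nhds_nonempty hpos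
  refine ⟨ψ + (AddMonoidHom.mulLeft ε).comp η, ?_, fun p hp => hεP p hp⟩
  rw [injective_iff_map_eq_zero]
  intro a ha
  by_contra h0
  refine hε ⟨a, ?_⟩
  simp only [AddMonoidHom.add_apply, AddMonoidHom.comp_apply, AddMonoidHom.coe_mulLeft] at ha
  have := hne a h0
  field_simp
  linarith

/-! ### The integral cocycle of a circular order -/

open Classical in
/-- The indicator of `x ≠ y`. -/
noncomputable def neInd {A : Type*} (x y : A) : ℤ := if x = y then 0 else 1

@[simp]
theorem neInd_self {A : Type*} (x : A) : neInd x x = 0 := by simp [neInd]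

theorem neInd_of_ne {A : Type*} {x y : A} (h : x ≠ y) : neInd x y = 1 := by simp [neInd, h]

theorem neInd_one_inv {A : Type*} [Group A] (x : A) : neInd 1 x⁻¹ = neInd 1 x := by
  have h : 1 = x⁻¹ ↔ 1 = x := by rw [eq_comm, inv_eq_one, eq_comm]
  by_cases hx : 1 = x
  · exact (if_pos (h.2 hx)).trans (if_pos hx).symm
  · exact (if_neg (mt h.1 hx)).trans (if_neg hx).symm

/-- The sign of the comparison of two elements of a linear order. -/
def cmpSign {α : Type*} [LinearOrder α] (u v : α) : ℤ := if u < v then 1 else if v < u then -1 else 0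

section
variable {α : Type*} [LinearOrder α] {u v : α}

theorem cmpSign_of_lt (h : u < v) : cmpSign u v = 1 := by simp [cmpSign, h]

theorem cmpSign_of_gt (h : v < u) : cmpSign u v = -1 := by simp [cmpSign, h, h.not_gt]

@[simp]
theorem cmpSign_self (u : α) : cmpSign u u = 0 := by simp [cmpSign]

theorem StrictMonoOn.cmpSign_eq {β : Type*} [LinearOrder β] {f : α → β} {s : Set α}
    (hf : StrictMonoOn f s) (hu : u ∈ s) (hv : v ∈ s) : cmpSign (f u) (f v) = cmpSign u v := by
  simp only [cmpSign, hf.lt_iff_lt hu hv, hf.lt_iff_lt hv hu]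

end

namespace IsCircularOrder

section
variable {G : Type*} [Group G] {φ : G × G × G → SignType} (hφ : IsCircularOrder φ)
include hφ

theorem self_left (x y : G) : φ (x, x, y) = 0 := (hφ.eq_zero_iff _ _ _).2 (Or.inl rfl)

theorem self_right (x y : G) : φ (x, y, y) = 0 := (hφ.eq_zero_iff _ _ _).2 (Or.inr (Or.inl rfl))

theorem self_outer (x y : G) : φ (x, y, x) = 0 := (hφ.eq_zero_iff _ _ _).2 (Or.inr (Or.inr rfl))

theorem swap_right (x y z : G) : (φ (x, z, y) : ℤ) = -(φ (x, y, z) : ℤ) := by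
  have h := hφ.cocycle x y z y
  simp only [hφ.self_outer, hφ.self_right, SignType.coe_zero] at h
  linarith

end
end IsCircularOrder

/-- The `{0, 1}`-valued group cocycle attached to a homogeneous cocycle `φ`. -/
noncomputable def liftCocycle {G : Type*} [Group G] (φ : G × G × G → SignType) (a b : G) : ℤ :=
  (neInd 1 a + neInd 1 b - neInd 1 (a * b) - (φ (1, a, a * b) : ℤ)) / 2

namespace IsCircularOrder

section
variable {G : Type*} [Group G] {φ : G × G × G → SignType} (hφ : IsCircularOrder φ)
include hφ

/-- The coboundary of `neInd 1` fixes the parity: the right side is 1 ∓ 1 on nondegenerate triples,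
and 0 or 2 on degenerate ones. -/
theorem two_mul_liftCocycle_and_mem (a b : G) :
    2 * liftCocycle φ a b =
      neInd 1 a + neInd 1 b - neInd 1 (a * b) - (φ (1, a, a * b) : ℤ) ∧
    0 ≤ liftCocycle φ a b ∧ liftCocycle φ a b ≤ 1 := by
  unfold liftCocycle
  by_cases ha : a = 1
  · subst ha; simp [hφ.self_left]
  by_cases hb : b = 1
  · subst hb; simp [hφ.self_right]
  by_cases hab : a * b = 1
  · rw [hab, hφ.self_outer, neInd_of_ne (Ne.symm ha), neInd_of_ne (Ne.symm hb)]
    simp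
  · rw [neInd_of_ne (Ne.symm ha), neInd_of_ne (Ne.symm hb), neInd_of_ne (Ne.symm hab)]
    have h0 : φ (1, a, a * b) ≠ 0 := by
      rw [Ne, hφ.eq_zero_iff]
      rintro (h | h | h)
      · exact ha h.symm
      · exact hb (by simpa using h)
      · exact hab h.symm
    rcases h : φ (1, a, a * b) with _ | _ | _
    · exact absurd h h0
    · norm_num
    · norm_num

theorem two_mul_liftCocycle (a b : G) : 2 * liftCocycle φ a b =
    neInd 1 a + neInd 1 b - neInd 1 (a * b) - (φ (1, a, a * b) : ℤ) :=
  (hφ.two_mul_liftCocycle_and_mem a b).1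

theorem liftCocycle_nonneg (a b : G) : 0 ≤ liftCocycle φ a b :=
  (hφ.two_mul_liftCocycle_and_mem a b).2.1

theorem liftCocycle_le_one (a b : G) : liftCocycle φ a b ≤ 1 :=
  (hφ.two_mul_liftCocycle_and_mem a b).2.2

theorem liftCocycle_assoc (a b d : G) :
    liftCocycle φ a b + liftCocycle φ (a * b) d =
      liftCocycle φ b d + liftCocycle φ a (b * d) := by
  have h1 := hφ.two_mul_liftCocycle a b
  have h2 := hφ.two_mul_liftCocycle (a * b) d
  have h3 := hφ.two_mul_liftCocycle b d
  have h4 := hφ.two_mul_liftCocycle a (b * d)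
  have h5 := hφ.cocycle 1 a (a * b) (a * b * d)
  have h6 := hφ.homogeneous a 1 b (b * d)
  rw [mul_one, ← mul_assoc] at h6
  rw [h6] at h5
  rw [← mul_assoc] at h4
  linarith

theorem liftCocycle_one_left (b : G) : liftCocycle φ 1 b = 0 := by
  have := hφ.two_mul_liftCocycle 1 b
  simp only [one_mul, neInd_self, hφ.self_left, SignType.coe_zero] at this
  linarith

theorem liftCocycle_inv_right (a : G) : liftCocycle φ a a⁻¹ = neInd 1 a := by
  have := hφ.two_mul_liftCocycle a a⁻¹
  simp only [mul_inv_cancel, neInd_self, hφ.self_outer, SignType.coe_zero, neInd_one_inv] at this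
  linarith

end

/-- The cocycle of a circular order on an abelian group is symmetric: its antisymmetrization is
bilinear and bounded, hence zero. -/
theorem liftCocycle_comm {A : Type*} [CommGroup A] {φ : A × A × A → SignType}
    (hφ : IsCircularOrder φ) (a b : A) : liftCocycle φ a b = liftCocycle φ b a := by
  -- For the antisymmetrization β, these three instances give β(a², b) = 2 β(a, b). As |β| ≤ 1 and β
  -- is integral, β(a, b) = 0.
  have h1 := hφ.liftCocycle_assoc a a b
  have h2 := hφ.liftCocycle_assoc b a a
  have h3 := hφ.liftCocycle_assoc a b a
  rw [mul_comm b a] at h2 h3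
  have h4 := hφ.liftCocycle_nonneg (a * a) b
  have h5 := hφ.liftCocycle_nonneg b (a * a)
  have h6 := hφ.liftCocycle_le_one (a * a) b
  have h7 := hφ.liftCocycle_le_one b (a * a)
  omega

end IsCircularOrder

/-! ### The unwrapped linear order -/

/-- The central extension of `A` by `ℤ` which unwraps a circular order on `A` to a linear order. -/
@[ext]
structure CircularLift {A : Type*} [CommGroup A] (c : CO A) where
  /-- The winding number. -/
  winding : ℤ
  /-- The image in the base group. -/
  base : A

namespace CircularLift

variable {A : Type*} [CommGroup A] {c : CO A}

instance : Zero (CircularLift c) := ⟨⟨0, 1⟩⟩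

noncomputable instance : Add (CircularLift c) :=
  ⟨fun x y => ⟨x.winding + y.winding + liftCocycle c.1 x.base y.base, x.base * y.base⟩⟩

noncomputable instance : Neg (CircularLift c) :=
  ⟨fun x => ⟨-x.winding - neInd 1 x.base, x.base⁻¹⟩⟩

@[simp] theorem winding_zero : (0 : CircularLift c).winding = 0 := rfl
@[simp] theorem base_zero : (0 : CircularLift c).base = 1 := rfl
@[simp] theorem winding_add (x y : CircularLift c) :
    (x + y).winding = x.winding + y.winding + liftCocycle c.1 x.base y.base := rfl
@[simp] theorem base_add (x y : CircularLift c) : (x + y).base = x.base * y.base := rfl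
@[simp] theorem winding_neg (x : CircularLift c) :
    (-x).winding = -x.winding - neInd 1 x.base := rfl
@[simp] theorem base_neg (x : CircularLift c) : (-x).base = x.base⁻¹ := rfl

noncomputable instance : AddCommGroup (CircularLift c) where
  add_assoc x y z := by
    ext
    · have := c.2.liftCocycle_assoc x.base y.base z.base
      simp only [winding_add, base_add]
      linarith
    · simp [mul_assoc]
  zero_add x := by ext <;> simp [c.2.liftCocycle_one_left]
  add_zero x := by ext <;> simp [c.2.liftCocycle_comm x.base, c.2.liftCocycle_one_left]
  add_comm x y := by
    ext
    · simp only [winding_add, c.2.liftCocycle_comm x.base]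
      ring
    · simp [mul_comm]
  neg_add_cancel x := by
    ext
    · simp only [winding_add, winding_neg, base_neg, c.2.liftCocycle_comm x.base⁻¹,
        c.2.liftCocycle_inv_right, winding_zero]
      ring
    · simp
  nsmul := nsmulRec
  zsmul := zsmulRec

/-- The elements of nonnegative winding number form the positive cone of the lift. -/
def posCone (c : CO A) : AddGroupCone (CircularLift c) where
  carrier := {x | 0 ≤ x.winding}
  zero_mem' := by simp
  add_mem' {x y} hx hy := by
    simp only [Set.mem_ofPred_eq] at hx hy ⊢
    exact add_nonneg (add_nonneg hx hy) (c.2.liftCocycle_nonneg _ _)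
  eq_zero_of_mem_of_neg_mem' {x} hx hy := by
    simp only [Set.mem_ofPred_eq, winding_neg] at hx hy
    by_cases h : x.base = 1
    · rw [h, neInd_self] at hy
      exact CircularLift.ext (by rw [winding_zero]; omega) h
    · rw [neInd_of_ne (Ne.symm h)] at hy
      omega

theorem mem_posCone {x : CircularLift c} : x ∈ posCone c ↔ 0 ≤ x.winding := by
  change x ∈ {x : CircularLift c | 0 ≤ x.winding} ↔ _
  rw [Set.mem_ofPred_eq]

/-- The winding numbers of `x` and `-x` sum to 0 over the identity and to -1 elsewhere, so they are
never both negative. -/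
instance : HasMemOrNegMem (posCone c) where
  mem_or_neg_mem x := by
    simp only [mem_posCone, winding_neg]
    by_cases h : x.base = 1
    · rw [h, neInd_self]
      omega
    · rw [neInd_of_ne (Ne.symm h)]
      omega

open Classical in
noncomputable instance : LinearOrder (CircularLift c) := LinearOrder.mkOfAddGroupCone (posCone c)

instance : IsOrderedAddMonoid (CircularLift c) := IsOrderedAddMonoid.mkOfCone (posCone c)

theorem nonneg_iff {x : CircularLift c} : 0 ≤ x ↔ 0 ≤ x.winding := by
  rw [← mem_posCone]
  change x - 0 ∈ posCone c ↔ _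
  rw [sub_zero]

/-- The lift of a group element with winding number zero. -/
def lift (c : CO A) (a : A) : CircularLift c := ⟨0, a⟩

end CircularLift

namespace CircularLift

variable {A : Type*} [CommGroup A] {c : CO A}

theorem lift_one : lift c 1 = 0 := rfl

theorem lift_nonneg (a : A) : 0 ≤ lift c a := nonneg_iff.2 le_rfl

theorem lift_injective : Function.Injective (lift c) := fun _ _ h => congrArg base h

theorem lift_pos {a : A} (ha : a ≠ 1) : 0 < lift c a :=
  (lift_nonneg a).lt_of_ne fun h => ha (lift_injective (lift_one.trans h)).symm

/-- The positive generator of the kernel of the projection to the base group. -/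
def generator (c : CO A) : CircularLift c := ⟨1, 1⟩

theorem zsmul_generator (n : ℤ) : n • generator c = ⟨n, 1⟩ := by
  induction n using Int.induction_on with
  | zero => rw [zero_zsmul]; rfl
  | succ n ih =>
    rw [add_zsmul, ih, one_zsmul]
    ext <;> simp [generator, c.2.liftCocycle_one_left]
  | pred n ih =>
    rw [sub_zsmul, ih, one_zsmul, sub_eq_add_neg]
    ext <;> simp [generator, c.2.liftCocycle_one_left, sub_eq_add_neg]

theorem lift_add_lift (a b : A) :
    lift c a + lift c b = liftCocycle c.1 a b • generator c + lift c (a * b) := by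
  rw [zsmul_generator]
  ext <;> simp [lift, c.2.liftCocycle_one_left]

theorem lift_lt_generator (a : A) : lift c a < generator c := by
  rw [← sub_pos]
  refine lt_of_le_of_ne (nonneg_iff.2 ?_) fun h => ?_
  · rw [sub_eq_add_neg]
    simp only [winding_add, winding_neg, generator, lift, base_neg, c.2.liftCocycle_one_left]
    by_cases h : a = 1
    · simp [h]
    · simp [neInd_of_ne (Ne.symm h)]
  · have := congrArg winding (sub_eq_zero.1 h.symm)
    simp [generator, lift] at this

/-- A positive triple makes the cocycle vanish at `(a, a⁻¹ * b)`, so `lift c b` is `lift c a` plus a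
positive lift. -/
theorem lift_lt_lift {a b : A} (h : c.1 (1, a, b) = 1) : lift c a < lift c b := by
  have h0 : ¬ (1 = a ∨ a = b ∨ 1 = b) := by
    rw [← c.2.eq_zero_iff, h]
    decide
  push Not at h0
  have hab : 1 ≠ a⁻¹ * b := fun h' => h0.2.1 (inv_mul_eq_one.1 h'.symm)
  have h2 := c.2.two_mul_liftCocycle a (a⁻¹ * b)
  rw [mul_inv_cancel_left, h, neInd_of_ne h0.1, neInd_of_ne h0.2.2, neInd_of_ne hab,
    SignType.coe_one] at h2
  have h3 : liftCocycle c.1 a (a⁻¹ * b) = 0 := by omega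
  have h4 := lift_add_lift (c := c) a (a⁻¹ * b)
  rw [h3, zero_zsmul, zero_add, mul_inv_cancel_left] at h4
  rw [← h4]
  exact lt_add_of_pos_right _ (lift_pos hab.symm)

/-- The lift of 1 is the least lift; the `neInd` terms cancel the comparisons with it when `a` or
`b` is 1. -/
theorem apply_one_eq_cmpSign (a b : A) : (c.1 (1, a, b) : ℤ) =
    cmpSign (lift c a) (lift c b) + neInd 1 a - neInd 1 b := by
  by_cases ha : a = 1
  · subst ha
    rw [c.2.self_left, SignType.coe_zero, neInd_self]
    by_cases hb : b = 1
    · simp [hb]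
    · rw [lift_one, cmpSign_of_lt (lift_pos hb), neInd_of_ne (Ne.symm hb)]
      rfl
  by_cases hb : b = 1
  · subst hb
    rw [c.2.self_outer, SignType.coe_zero, neInd_self, lift_one, cmpSign_of_gt (lift_pos ha),
      neInd_of_ne (Ne.symm ha)]
    rfl
  rw [neInd_of_ne (Ne.symm ha), neInd_of_ne (Ne.symm hb), add_sub_cancel_right]
  by_cases hab : a = b
  · subst hab
    simp [c.2.self_right]
  have h0 : c.1 (1, a, b) ≠ 0 := by
    rw [Ne, c.2.eq_zero_iff]
    rintro (h | h | h)
    exacts [ha h.symm, hab h, hb h.symm]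
  rcases h : c.1 (1, a, b) with _ | _ | _
  · exact absurd h h0
  · have h1 : c.1 (1, b, a) = 1 := by
      have h2 := c.2.swap_right 1 a b
      rw [h] at h2
      rcases h3 : c.1 (1, b, a) with _ | _ | _ <;> rw [h3] at h2 <;> simp at h2 ⊢
    rw [cmpSign_of_gt (lift_lt_lift h1)]
    rfl
  · rw [cmpSign_of_lt (lift_lt_lift h)]
    rfl

/-- The circular order is determined by the linear order of the lifts. -/
theorem apply_eq_cmpSign (x y z : A) : (c.1 (x, y, z) : ℤ) =
    cmpSign (lift c x) (lift c y) + cmpSign (lift c y) (lift c z) -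
      cmpSign (lift c x) (lift c z) := by
  have h := c.2.cocycle 1 x y z
  rw [apply_one_eq_cmpSign, apply_one_eq_cmpSign, apply_one_eq_cmpSign] at h
  linarith

instance [Countable A] : Countable (CircularLift c) :=
  Function.Injective.countable (f := fun x : CircularLift c => (x.winding, x.base))
    fun _ _ h => CircularLift.ext (congrArg Prod.fst h) (congrArg Prod.snd h)

end CircularLift

/-! ### Orientation of triples on the circle -/

theorem btw_add_left_iff (w x y z : UnitAddCircle) : btw (w + x) (w + y) (w + z) ↔ btw x y z := by
  change (_ : ℝ) ≤ _ ↔ (_ : ℝ) ≤ _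
  rw [add_sub_add_left_eq_sub, add_sub_add_left_eq_sub]

theorem circleOrientation_add_left (w x y z : UnitAddCircle) :
    circleOrientation (w + x) (w + y) (w + z) = circleOrientation x y z := by
  have h (a b d : UnitAddCircle) : sbtw (w + a) (w + b) (w + d) ↔ sbtw a b d := by
    rw [sbtw_iff_not_btw, sbtw_iff_not_btw, btw_add_left_iff]
  unfold circleOrientation
  split_ifs <;> simp_all only [not_true, not_false_eq_true]

theorem circleOrientation_of_sbtw {x y z : UnitAddCircle} (h : sbtw x y z) :
    circleOrientation x y z = 1 := by
  simp [circleOrientation, h]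

theorem circleOrientation_of_sbtw_rev {x y z : UnitAddCircle} (h : sbtw z y x) :
    circleOrientation x y z = -1 := by
  simp [circleOrientation, h, sbtw_asymm h]

theorem circleOrientation_eq_zero_iff (x y z : UnitAddCircle) :
    circleOrientation x y z = 0 ↔ x = y ∨ y = z ∨ x = z := by
  constructor
  · intro h
    have h1 : ¬ sbtw x y z := fun h' => by simp [circleOrientation_of_sbtw h'] at h
    have h2 : ¬ sbtw z y x := fun h' => by simp [circleOrientation_of_sbtw_rev h'] at h
    rw [← btw_iff_not_sbtw] at h1 h2
    rcases h2.antisymm h1 with h | h | h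
    exacts [Or.inl h, Or.inr (Or.inl h), Or.inr (Or.inr h.symm)]
  · rintro (rfl | rfl | rfl) <;>
      simp [circleOrientation, sbtw_irrefl_left, sbtw_irrefl_right, sbtw_irrefl_left_right]

theorem sbtw_coe_of_lt {s t u : ℝ} (hst : s < t) (htu : t < u) (hus : u < s + 1) :
    sbtw (s : UnitAddCircle) t u := by
  rw [sbtw_iff_not_btw]
  change ¬ btw ((u : ℝ ⧸ AddSubgroup.zmultiples (1 : ℝ))) (t : ℝ ⧸ AddSubgroup.zmultiples (1 : ℝ))
    (s : ℝ ⧸ AddSubgroup.zmultiples (1 : ℝ))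
  rw [QuotientAddGroup.btw_coe_iff]
  -- The representatives of `t` and `s` just above `u` are `t + 1` and `s + 1`, so `btw u t s` would
  -- force `t ≤ s`.
  have h1 : toIcoMod (one_pos : (0 : ℝ) < 1) u t = t + 1 := by
    rw [toIcoMod_eq_iff]
    exact ⟨⟨by linarith, by linarith⟩, -1, by simp⟩
  have h2 : toIocMod (one_pos : (0 : ℝ) < 1) u s = s + 1 := by
    rw [toIocMod_eq_iff]
    exact ⟨⟨by linarith, by linarith⟩, -1, by simp⟩
  rw [h1, h2]
  linarith

/-- In terms of representatives in `[0, 1)`, the orientation is a coboundary. -/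
theorem circleOrientation_coe {s t u : ℝ} (hs : s ∈ Set.Ico (0 : ℝ) 1) (ht : t ∈ Set.Ico (0 : ℝ) 1)
    (hu : u ∈ Set.Ico (0 : ℝ) 1) : (circleOrientation (s : UnitAddCircle) t u : ℤ) =
      cmpSign s t + cmpSign t u - cmpSign s u := by
  obtain ⟨hs0, hs1⟩ := hs
  obtain ⟨ht0, ht1⟩ := ht
  obtain ⟨hu0, hu1⟩ := hu
  rcases lt_trichotomy s t with h1 | rfl | h1
  · rcases lt_trichotomy t u with h2 | rfl | h2
    · rw [circleOrientation_of_sbtw (sbtw_coe_of_lt h1 h2 (by linarith)), cmpSign_of_lt h1,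
        cmpSign_of_lt h2, cmpSign_of_lt (h1.trans h2)]
      rfl
    · simp [(circleOrientation_eq_zero_iff _ _ _).2 (Or.inr (Or.inl rfl))]
    · rcases lt_trichotomy s u with h3 | rfl | h3
      · rw [circleOrientation_of_sbtw_rev (sbtw_cyclic_left (sbtw_coe_of_lt h3 h2 (by linarith))),
          cmpSign_of_lt h1, cmpSign_of_gt h2, cmpSign_of_lt h3]
        rfl
      · rw [(circleOrientation_eq_zero_iff _ _ _).2 (Or.inr (Or.inr rfl)), cmpSign_of_lt h1,
          cmpSign_of_gt h1]
        simp
      · rw [circleOrientation_of_sbtw (sbtw_cyclic_left (sbtw_coe_of_lt h3 h1 (by linarith))),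
          cmpSign_of_lt h1, cmpSign_of_gt h2, cmpSign_of_gt h3]
        rfl
  · simp [(circleOrientation_eq_zero_iff _ _ _).2 (Or.inl rfl)]
  · rcases lt_trichotomy t u with h2 | rfl | h2
    · rcases lt_trichotomy s u with h3 | rfl | h3
      · rw [circleOrientation_of_sbtw_rev (sbtw_cyclic_right (sbtw_coe_of_lt h1 h3 (by linarith))),
          cmpSign_of_gt h1, cmpSign_of_lt h2, cmpSign_of_lt h3]
        rfl
      · rw [(circleOrientation_eq_zero_iff _ _ _).2 (Or.inr (Or.inr rfl)), cmpSign_of_gt h1,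
          cmpSign_of_lt h1]
        simp
      · rw [circleOrientation_of_sbtw (sbtw_cyclic_right (sbtw_coe_of_lt h2 h3 (by linarith))),
          cmpSign_of_gt h1, cmpSign_of_lt h2, cmpSign_of_gt h3]
        rfl
    · simp [(circleOrientation_eq_zero_iff _ _ _).2 (Or.inr (Or.inl rfl))]
    · rw [circleOrientation_of_sbtw_rev (sbtw_coe_of_lt h2 h1 (by linarith)), cmpSign_of_gt h1,
        cmpSign_of_gt h2, cmpSign_of_gt (h2.trans h1)]
      rfl

theorem exists_coe_eq_mem_Ico (x : UnitAddCircle) :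
    ∃ s ∈ Set.Ico (0 : ℝ) 1, (s : UnitAddCircle) = x :=
  ⟨AddCircle.equivIco 1 0 x, by simpa using (AddCircle.equivIco 1 0 x).2,
    (AddCircle.equivIco 1 0).symm_apply_apply x⟩

theorem circleOrientation_cocycle (g₀ g₁ g₂ g₃ : UnitAddCircle) :
    (circleOrientation g₁ g₂ g₃ : ℤ) - circleOrientation g₀ g₂ g₃ +
      circleOrientation g₀ g₁ g₃ - circleOrientation g₀ g₁ g₂ = 0 := by
  obtain ⟨s₀, h₀, rfl⟩ := exists_coe_eq_mem_Ico g₀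
  obtain ⟨s₁, h₁, rfl⟩ := exists_coe_eq_mem_Ico g₁
  obtain ⟨s₂, h₂, rfl⟩ := exists_coe_eq_mem_Ico g₂
  obtain ⟨s₃, h₃, rfl⟩ := exists_coe_eq_mem_Ico g₃
  rw [circleOrientation_coe h₁ h₂ h₃, circleOrientation_coe h₀ h₂ h₃,
    circleOrientation_coe h₀ h₁ h₃, circleOrientation_coe h₀ h₁ h₂]
  ring

/-! ### Rotation orders from injective characters -/

/-- In a locally connected space, the components of the complement of a closed set have their
frontier in that set. -/
theorem IsClosed.frontier_connectedComponentIn_compl_subset {X : Type*} [TopologicalSpace X]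
    [LocallyConnectedSpace X] {K : Set X} (hK : IsClosed K) (x : X) :
    frontier (connectedComponentIn Kᶜ x) ⊆ K := by
  intro y hy
  by_contra hyK
  have hopen : IsOpen (connectedComponentIn Kᶜ x) := hK.isOpen_compl.connectedComponentIn
  rw [hopen.frontier_eq] at hy
  have hy' : y ∈ connectedComponentIn Kᶜ y := mem_connectedComponentIn hyK
  obtain ⟨w, hw1, hw2⟩ := mem_closure_iff.1 hy.1 _
    (hK.isOpen_compl.connectedComponentIn (x := y)) hy'
  rw [connectedComponentIn_eq hw1, ← connectedComponentIn_eq hw2] at hy'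
  exact hy.2 hy'

/-- A subgroup of the circle is dense or closed. -/
theorem AddSubgroup.dense_or_isClosed_unitAddCircle (s : AddSubgroup UnitAddCircle) :
    Dense (s : Set UnitAddCircle) ∨ IsClosed (s : Set UnitAddCircle) := by
  by_contra! h
  obtain ⟨h1, h2⟩ := h
  rw [AddCircle.dense_addSubgroup_iff_ne_zmultiples] at h1
  push Not at h1
  obtain ⟨a, ha, rfl⟩ := h1
  refine h2 (Set.Finite.isClosed ?_)
  have : IsOfFinAddOrder a := addOrderOf_ne_zero_iff.1 ha
  exact finite_zmultiples.2 this

/-- The rotation `x ↦ x + t` as an element of `Homeo₊(S¹)`. -/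
def circleRotation (t : UnitAddCircle) : HomeoPlus :=
  ⟨Homeomorph.addRight t, fun x y z => by
    simp only [Homeomorph.coe_addRight, add_comm _ t, circleOrientation_add_left]⟩

@[simp]
theorem circleRotation_apply (t x : UnitAddCircle) : (circleRotation t).1 x = x + t := rfl

/-- The rotation action attached to a character. -/
def rotationHom {A : Type*} [CommGroup A] (ρ : A →* Multiplicative UnitAddCircle) :
    A →* HomeoPlus where
  toFun a := circleRotation (ρ a).toAdd
  map_one' := by
    refine Subtype.ext (Homeomorph.ext fun x => ?_)
    simp
  map_mul' a b := by
    refine Subtype.ext (Homeomorph.ext fun x => ?_)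
    change x + (ρ (a * b)).toAdd = x + (ρ b).toAdd + (ρ a).toAdd
    rw [map_mul, toAdd_mul]
    abel

/-- The circular order pulled back from the circle along an injective character. -/
noncomputable def pullbackOrder {A : Type*} [CommGroup A] (ρ : A →* Multiplicative UnitAddCircle)
    (hρ : Function.Injective ρ) : CO A :=
  ⟨fun g => circleOrientation (ρ g.1).toAdd (ρ g.2.1).toAdd (ρ g.2.2).toAdd,
    { eq_zero_iff := fun x y z => by
        simp only [circleOrientation_eq_zero_iff, EmbeddingLike.apply_eq_iff_eq, hρ.eq_iff]
      cocycle := fun g₀ g₁ g₂ g₃ => circleOrientation_cocycle _ _ _ _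
      homogeneous := fun g x y z => by
        simp only [map_mul, toAdd_mul, circleOrientation_add_left] }⟩

/-- The orbit of 0 is the image subgroup. If it is dense there are no gaps; otherwise it is closed
and contains the frontier of every gap. -/
theorem pullbackOrder_mem_COrot {A : Type*} [CommGroup A] (ρ : A →* Multiplicative UnitAddCircle)
    (hρ : Function.Injective ρ) : pullbackOrder ρ hρ ∈ COrot A := by
  have happly : ∀ g, ((rotationHom ρ) g).1 0 = (ρ g).toAdd := fun g => by simp [rotationHom]
  refine ⟨rotationHom ρ, 0, ⟨fun g hg => ?_, fun x y z => ?_, ?_⟩, fun g => ⟨_, fun x => rfl⟩⟩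
  · rw [happly] at hg
    exact hρ (by rw [map_one]; exact hg)
  · simp only [happly]
    rfl
  · simp only [happly]
    have hrange : (Set.range fun g => (ρ g).toAdd) = (ρ.toAdditiveLeft.range : Set UnitAddCircle) := by
      ext x
      rfl
    rw [hrange]
    intro x hx
    have : LocallyConnectedSpace UnitAddCircle := inferInstanceAs (LocallyConnectedSpace (Quotient _))
    rcases AddSubgroup.dense_or_isClosed_unitAddCircle ρ.toAdditiveLeft.range with h | h
    · exact absurd (h x) hx
    · rw [h.closure_eq]
      exact h.frontier_connectedComponentIn_compl_subset x

/-! ### Approximation on finite sets and density -/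

theorem countable_of_group_fg (G : Type*) [Group G] [Group.FG G] : Countable G := by
  obtain ⟨S, hS⟩ := Group.fg_def.1 ‹Group.FG G›
  have h : Function.Surjective (FreeGroup.lift ((↑) : S → G)) := by
    rw [← MonoidHom.range_eq_top, FreeGroup.range_lift_eq_closure, Subtype.range_coe]
    exact hS
  have : Countable (FreeGroup S) := inferInstanceAs (Countable (Quot _))
  exact h.countable

/-- A finite part of a linear order on a countable abelian group is induced by some embedding into
the reals, which may be normalized at a positive element. -/
theorem exists_addMonoidHom_real_strictMonoOn {M : Type*} [AddCommGroup M] [LinearOrder M]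
    [IsOrderedAddMonoid M] [Countable M] (T : Finset M) {z : M} (hz : 0 < z) :
    ∃ ψ : M →+ ℝ, Function.Injective ψ ∧ ψ z = 1 ∧ StrictMonoOn ψ T := by
  classical
  -- Positivity on these differences is strict monotonicity on `T`; `z` is added to permit division
  -- by `ψ z`.
  let P := insert z (((T ×ˢ T).filter fun p => p.1 < p.2).image fun p => p.2 - p.1)
  obtain ⟨ψ, hinj, hpos⟩ := exists_addMonoidHom_real_injective_pos P (by
    intro p hp
    simp only [P, Finset.mem_insert, Finset.mem_image, Finset.mem_filter] at hp
    rcases hp with rfl | ⟨q, hq, rfl⟩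
    exacts [hz, sub_pos.2 hq.2])
  have hψz : 0 < ψ z := hpos z (Finset.mem_insert_self _ _)
  refine ⟨(AddMonoidHom.mulLeft (ψ z)⁻¹).comp ψ, ?_, ?_, ?_⟩
  · exact (mul_right_injective₀ (inv_ne_zero hψz.ne')).comp hinj
  · simp [hψz.ne']
  · intro s hs t ht hst
    have h : 0 < ψ (t - s) := hpos _ (Finset.mem_insert_of_mem (Finset.mem_image.2
      ⟨(s, t), Finset.mem_filter.2 ⟨Finset.mem_product.2 ⟨hs, ht⟩, hst⟩, rfl⟩))
    rw [map_sub, sub_pos] at h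
    simpa using mul_lt_mul_of_pos_left h (inv_pos.2 hψz)

namespace CircularLift

variable {A : Type*} [CommGroup A] {c : CO A}

/-- The character of the base group induced by a normalized homomorphism of the lift. -/
noncomputable def character (ψ : CircularLift c →+ ℝ) (hz : ψ (generator c) = 1) :
    A →* Multiplicative UnitAddCircle where
  toFun a := Multiplicative.ofAdd ((ψ (lift c a) : ℝ) : UnitAddCircle)
  map_one' := by simp [lift_one]
  map_mul' a b := by
    have h := congrArg ψ (lift_add_lift (c := c) a b)
    rw [map_add, map_add, map_zsmul, hz] at h
    rw [← ofAdd_add, ← AddCircle.coe_add, h, AddCircle.coe_add]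
    congr 1
    rw [AddCircle.coe_zsmul, AddCircle.coe_period, smul_zero, zero_add]

/-- If ψ of a lift is an integer n, it equals ψ(n z), so injectivity of ψ places the lift over the
identity. -/
theorem character_injective {ψ : CircularLift c →+ ℝ} (hz : ψ (generator c) = 1)
    (hψ : Function.Injective ψ) : Function.Injective (character ψ hz) := by
  rw [injective_iff_map_eq_one]
  intro a ha
  have h0 : ((ψ (lift c a) : ℝ) : UnitAddCircle) = 0 := ha
  obtain ⟨n, hn⟩ := (AddCircle.coe_eq_zero_iff (1 : ℝ)).1 h0
  rw [← hz, ← map_zsmul, zsmul_generator] at hn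
  exact (congrArg base (hψ hn)).symm

end CircularLift

open CircularLift in
/-- Every circular order on a countable abelian group agrees on any finite set with the order
pulled back along some injective character. -/
theorem exists_pullbackOrder_eqOn {A : Type*} [CommGroup A] [Countable A] (c : CO A)
    (F : Finset A) : ∃ (ρ : A →* Multiplicative UnitAddCircle) (hρ : Function.Injective ρ),
      ∀ x ∈ F, ∀ y ∈ F, ∀ z ∈ F, (pullbackOrder ρ hρ).1 (x, y, z) = c.1 (x, y, z) := by
  classical
  -- Including 0 and the generator forces the values of ψ on the lifts into [0, 1), where
  -- `circleOrientation_coe` applies.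
  let T : Finset (CircularLift c) := insert 0 (insert (generator c) (F.image (lift c)))
  have hpos : 0 < generator c := lift_lt_generator (c := c) 1
  obtain ⟨ψ, hinj, hz, hmono⟩ := exists_addMonoidHom_real_strictMonoOn T hpos
  have hT : ∀ x ∈ F, lift c x ∈ (T : Set (CircularLift c)) := fun x hx => by
    simp only [T, Finset.mem_coe, Finset.mem_insert, Finset.mem_image]
    exact Or.inr (Or.inr ⟨x, hx, rfl⟩)
  have hIco : ∀ x ∈ F, ψ (lift c x) ∈ Set.Ico (0 : ℝ) 1 := fun x hx => by
    constructor
    · rw [← map_zero ψ]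
      exact hmono.monotoneOn (by simp [T]) (hT x hx) (lift_nonneg x)
    · rw [← hz]
      exact hmono (hT x hx) (by simp [T]) (lift_lt_generator x)
  refine ⟨character ψ hz, character_injective hz hinj, fun x hx y hy z hz' => ?_⟩
  have h : (circleOrientation (ψ (lift c x) : UnitAddCircle) (ψ (lift c y) : ℝ)
      (ψ (lift c z) : ℝ) : ℤ) = c.1 (x, y, z) := by
    rw [circleOrientation_coe (hIco x hx) (hIco y hy) (hIco z hz'), apply_eq_cmpSign,
      hmono.cmpSign_eq (hT x hx) (hT y hy), hmono.cmpSign_eq (hT y hy) (hT z hz'),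
      hmono.cmpSign_eq (hT x hx) (hT z hz')]
  have hcast : Function.Injective fun s : SignType => (s : ℤ) := by decide
  exact hcast h

theorem theorem3p7 {A : Type*} [CommGroup A] [Group.FG A] : Dense (COrot A) := by
  classical
  have := countable_of_group_fg A
  rw [dense_iff_inter_open]
  rintro U hU ⟨c, hc⟩
  obtain ⟨V, hV, rfl⟩ := isOpen_induced_iff.1 hU
  obtain ⟨I, u, hu, hIV⟩ := isOpen_pi_iff.1 hV c.1 hc
  -- A basic open set constrains finitely many triples; `F` collects their entries.
  let F : Finset A := I.image (fun g => g.1) ∪ (I.image (fun g => g.2.1) ∪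
    I.image fun g => g.2.2)
  obtain ⟨ρ, hρ, h⟩ := exists_pullbackOrder_eqOn c F
  refine ⟨pullbackOrder ρ hρ, hIV fun g hg => ?_, pullbackOrder_mem_COrot ρ hρ⟩
  have h1 : g.1 ∈ F := Finset.mem_union_left _ (Finset.mem_image_of_mem (fun g => g.1) hg)
  have h2 : g.2.1 ∈ F := Finset.mem_union_right _ (Finset.mem_union_left _
    (Finset.mem_image_of_mem (fun g => g.2.1) hg))
  have h3 : g.2.2 ∈ F := Finset.mem_union_right _ (Finset.mem_union_right _
    (Finset.mem_image_of_mem (fun g => g.2.2) hg))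
  rw [show (pullbackOrder ρ hρ).1 g = c.1 g from h _ h1 _ h2 _ h3]
  exact (hu g hg).2
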